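/- Let $\mathbf x\sim\mathcal N(0,\sigma_x^2)$, $\mathbf v\sim\mathcal N(0,\sigma_v^2)$ and $\mathbf w\sim\mathcal N(0,\sigma_w^2)$ be independent with $\sigma_x,\sigma_v,\sigma_w>0$, and let $b\in\mathbb R$ and $\theta>0$. An encoder strategy is a Borel function $\gamma^e:\mathbb R\to\mathbb R$. A decoder strategy is a pair consisting of a number $\alpha\in[0,1]$ and a Borel function $\gamma^d:\mathbb R\to\mathbb R$. The decoder observes $$\mathbf r=\alpha(\gamma^e(\mathbf x)+\mathbf v)+(1-\alpha)(\mathbf x+\mathbf w)$$ and forms the estimate $\hat{\mathbf x}=\gamma^d(\mathbf r)$. The costs, with values in $[0,\infty]$, are $$J^d=\mathbf E[(\mathbf x-\hat{\mathbf x})^2],\qquad J^e=\mathbf E[(\mathbf x-\hat{\mathbf x}-b)^2+\theta\,\gamma^e(\mathbf x)^2].$$ A Stackelberg equilibrium (with the encoder as leader) consists of an encoder strategy $\gamma^{e}$ and a map $\delta$ assigning to every encoder strategy $\gamma$ a decoder strategy $\delta(\gamma)$, such that for every $\gamma$ the decoder strategy $\delta(\gamma)$ minimizes $J^d(\gamma,\cdot)$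 over all decoder strategies, and $J^e(\gamma^{e},\delta(\gamma^{e}))\le J^e(\gamma,\delta(\gamma))$ for every encoder strategy $\gamma$. **Theorem.** Let $A\ge 0$ be given by $$A^2=\begin{cases}\sqrt{\dfrac{\sigma_v^2}{\theta\sigma_x^2}}-\dfrac{\sigma_v^2}{\sigma_x^2}\Bigl(\dfrac{\sigma_x^2}{\sigma_w^2}+1\Bigr), & \text{if } \theta<\dfrac{\sigma_x^2}{\sigma_v^2\bigl(\frac{\sigma_x^2}{\sigma_w^2}+1\bigr)^2},\\[2ex] 0, & \text{otherwise,}\end{cases}$$ so that $A>0$ exactly in the first case, and put $$\alpha=\frac{A\sigma_w^2}{A\sigma_w^2+\sigma_v^2},\qquad K=\frac{A\sigma_x^2\sigma_w^2+\sigma_x^2\sigma_v^2}{A^2\sigma_x^2\sigma_w^2+\sigma_x^2\sigma_v^2+\sigma_w^2\sigma_v^2}\ge 0,\qquad J^{d,*}=\frac{\sigma_x^2\sigma_w^2\sigma_v^2}{(A^2\sigma_w^2+\sigma_v^2)\sigma_x^2+\sigma_w^2\sigma_v^2}.$$ Then there is a Stackelberg equilibrium in which the encoder uses $\gamma^e(x)=Ax$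 and the decoder responds to it with the ratio $\alpha$ and the estimator $\gamma^d(r)=Kr$. It is the only equilibrium, affine or not: in every Stackelberg equilibrium $(\gamma^e,\delta)$, $\gamma^e(x)=Ax$ for Lebesgue-almost every $x$, and the decoder strategy $\delta(\gamma^e)$ consists of the ratio $\alpha$ and an estimator $\gamma^d$ with $\gamma^d(r)=Kr$ for Lebesgue-almost every $r$. At every equilibrium the decoder cost is $J^{d,*}$ and the encoder cost is $$J^{e,*}=J^{d,*}+\theta A^2\sigma_x^2+b^2 .$$ -/

import Mathlib

open MeasureTheory ProbabilityTheory
open scoped ENNReal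

noncomputable section

namespace SignalingGame

/-- An encoder strategy: a Borel measurable map sending the source value `x` to the message. No
linearity and no bound on the transmit power is imposed. -/
structure Encoder where
  /-- the message sent for a given source value -/
  message : ℝ → ℝ
  measurable_message : Measurable message

/-- A decoder strategy: a combining ratio in `[0, 1]` together with a Borel measurable estimator
of the source from the combined observation. -/
structure Decoder where
  /-- the combining and utilization ratio of the channel from the encoder -/
  ratio : ℝ
  ratio_mem : ratio ∈ Set.Icc (0 : ℝ) 1
  /-- the estimate of the source as a function of the combined observation -/
  estimate : ℝ → ℝ
  measurable_estimate : Measurable estimate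

/-- The linear encoder `x ↦ A * x`. -/
def Encoder.linear (A : ℝ) : Encoder where
  message := fun x => A * x
  measurable_message := measurable_const_mul A

variable {Ω : Type*}

/-- The decoder input `r = α * y + (1 - α) * z`, with `y = γ(x) + v` and `z = x + w`. -/
def received (X V W : Ω → ℝ) (γ : Encoder) (α : ℝ) (ω : Ω) : ℝ :=
  α * (γ.message (X ω) + V ω) + (1 - α) * (X ω + W ω)

/-- The estimate of the source produced by the pair of strategies `(γ, d)`. -/
def reconstruction (X V W : Ω → ℝ) (γ : Encoder) (d : Decoder) (ω : Ω) : ℝ :=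
  d.estimate (received X V W γ d.ratio ω)

variable [MeasurableSpace Ω]

/-- The expected decoder cost, the expectation of `(x - x̂)²`. The integrand is nonnegative, and
the expectation is taken in `[0, ∞]`. -/
def decoderCost (P : Measure Ω) (X V W : Ω → ℝ) (γ : Encoder) (d : Decoder) : ℝ≥0∞ :=
  ∫⁻ ω, ENNReal.ofReal ((X ω - reconstruction X V W γ d ω) ^ 2) ∂P

/-- The expected encoder cost, the expectation of `(x - x̂ - b)² + θ * γ(x)²`. For `0 ≤ θ` the
integrand is nonnegative, and the expectation is taken in `[0, ∞]`. -/
def encoderCost (P : Measure Ω) (X V W : Ω → ℝ) (b θ : ℝ) (γ : Encoder) (d : Decoder) : ℝ≥0∞ :=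
  ∫⁻ ω, ENNReal.ofReal
    ((X ω - reconstruction X V W γ d ω - b) ^ 2 + θ * (γ.message (X ω)) ^ 2) ∂P

/-- The follower strategy `d` is an optimal reaction to the announced encoder strategy `γ`. -/
def IsBestResponse (P : Measure Ω) (X V W : Ω → ℝ) (γ : Encoder) (d : Decoder) : Prop :=
  ∀ d' : Decoder, decoderCost P X V W γ d ≤ decoderCost P X V W γ d'

/-- Stackelberg equilibrium with the encoder as leader: `δ` assigns to each announced encoder
strategy an optimal reaction of the decoder, and `γ` minimizes the encoder cost when this reaction
is anticipated. -/
structure IsStackelbergEquilibrium (P : Measure Ω) (X V W : Ω → ℝ) (b θ : ℝ)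
    (γ : Encoder) (δ : Encoder → Decoder) : Prop where
  follower : ∀ γ' : Encoder, IsBestResponse P X V W γ' (δ γ')
  leader : ∀ γ' : Encoder,
    encoderCost P X V W b θ γ (δ γ) ≤ encoderCost P X V W b θ γ' (δ γ')

end SignalingGame

end

/-!
For a fixed combining ratio the decoder sees a signal `s(x)` of power `S` in Gaussian noise of
variance `N`. Its error is at least `σx² N / (S + N)`: by the change of variables
`(x, n) ↦ (s(x) + n, x - g(s(x) + n))`, which preserves Lebesgue measure, the expectation of the
exponential of a log likelihood ratio is at most one, and Jensen's inequality bounds the mean of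
that log likelihood ratio. Cauchy-Schwarz bounds `(S + N) / N` by `1 + σx²/σw² + p/σv²`, where `p`
is the power of the encoder, with equality only if the message is proportional to the source and
the ratio is the corresponding maximal combining ratio. So an encoder of power `p` has a decoder
cost of at least `σx² / (1 + σx²/σw² + p/σv²)`, which linear strategies attain.

A best response leaves an error of mean zero, since otherwise subtracting the mean would improve
it. Hence `b` only adds `b²` to the encoder cost, and the encoder minimizes
`σx² / (1 + σx²/σw² + p/σv²) + θ p` over `p ≥ 0`, which has exactly one minimizer.

An optimal estimator for a given ratio exists and is almost everywhere unique, being the posterior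
mean. Its error is lower semicontinuous in the ratio by Fatou's lemma, so it attains a minimum on
`[0, 1]`, and every encoder strategy has a best response.
-/

noncomputable section

namespace SignalingGame

open Filter
open scoped NNReal Topology

/-! ### Additive Gaussian noise channels -/

lemma integral_sq_gaussianReal (v : ℝ≥0) : ∫ x, x ^ 2 ∂(gaussianReal 0 v) = v := by
  have h := variance_fun_id_gaussianReal (μ := 0) (v := v)
  rwa [variance_of_integral_eq_zero (by fun_prop) (by simp)] at h

lemma integral_sq_fst_add_snd {α β : Type*} [MeasurableSpace α] [MeasurableSpace β]
    {μ : Measure α} {ν : Measure β} [IsProbabilityMeasure μ] [IsProbabilityMeasure ν]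
    {f : α → ℝ} {g : β → ℝ} (hf : MemLp f 2 μ) (hg : MemLp g 2 ν) (hg₀ : ∫ y, g y ∂ν = 0) :
    ∫ z, (f z.1 + g z.2) ^ 2 ∂(μ.prod ν) = ∫ x, f x ^ 2 ∂μ + ∫ y, g y ^ 2 ∂ν := by
  have hf₂ : Integrable (fun z : α × β => f z.1 ^ 2) (μ.prod ν) := hf.integrable_sq.comp_fst ν
  have hg₂ : Integrable (fun z : α × β => g z.2 ^ 2) (μ.prod ν) := hg.integrable_sq.comp_snd μ
  have hfg₂ : Integrable (fun z : α × β => f z.1 ^ 2 + g z.2 ^ 2) (μ.prod ν) := hf₂.add hg₂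
  have hfg : Integrable (fun z : α × β => f z.1 * g z.2) (μ.prod ν) :=
    (hf.integrable one_le_two).mul_prod (hg.integrable one_le_two)
  calc ∫ z, (f z.1 + g z.2) ^ 2 ∂(μ.prod ν)
    _ = ∫ z, (f z.1 ^ 2 + g z.2 ^ 2 + 2 * (f z.1 * g z.2)) ∂(μ.prod ν) := by
      congr with z
      ring
    _ = ∫ z, f z.1 ^ 2 ∂(μ.prod ν) + ∫ z, g z.2 ^ 2 ∂(μ.prod ν)
        + 2 * ∫ z, f z.1 * g z.2 ∂(μ.prod ν) := by
      rw [integral_add hfg₂ (hfg.const_mul 2), integral_add hf₂ hg₂, integral_const_mul]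
    _ = ∫ x, f x ^ 2 ∂μ + ∫ y, g y ^ 2 ∂ν := by
      rw [integral_prod_mul, hg₀, integral_fun_fst (fun x => f x ^ 2),
        integral_fun_snd (fun y => g y ^ 2)]
      simp

/-- The mean square error of the estimator `g` of a source with law `μ`, when the signal `s x` is
received in independent Gaussian noise of variance `v`. -/
def channelError (μ : Measure ℝ) (v : ℝ≥0) (s g : ℝ → ℝ) : ℝ≥0∞ :=
  ∫⁻ z, ENNReal.ofReal ((z.1 - g (s z.1 + z.2)) ^ 2) ∂(μ.prod (gaussianReal 0 v))

lemma channelError_congr {μ : Measure ℝ} (v : ℝ≥0) {s s' : ℝ → ℝ} (h : s =ᵐ[μ] s') (g : ℝ → ℝ) :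
    channelError μ v s g = channelError μ v s' g := by
  refine lintegral_congr_ae ?_
  filter_upwards [Measure.quasiMeasurePreserving_fst.ae h] with z hz
  rw [hz]

lemma lintegral_channel (μ : Measure ℝ) [SFinite μ] {v : ℝ≥0} (hv : v ≠ 0) {s : ℝ → ℝ}
    (hs : Measurable s) {f : ℝ → ℝ → ℝ≥0∞} (hf : Measurable (Function.uncurry f)) :
    ∫⁻ z, f z.1 (s z.1 + z.2) ∂(μ.prod (gaussianReal 0 v)) =
      ∫⁻ r, ∫⁻ x, f x r * gaussianPDF 0 v (r - s x) ∂μ := by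
  have hout : Measurable fun z : ℝ × ℝ => f z.1 (s z.1 + z.2) :=
    hf.comp (measurable_fst.prodMk ((hs.comp measurable_fst).add measurable_snd))
  have hden : Measurable fun z : ℝ × ℝ => f z.1 z.2 * gaussianPDF 0 v (z.2 - s z.1) :=
    hf.mul ((measurable_gaussianPDF 0 v).comp (measurable_snd.sub (hs.comp measurable_fst)))
  rw [lintegral_prod _ hout.aemeasurable,
    ← lintegral_lintegral_swap (f := fun x r => f x r * gaussianPDF 0 v (r - s x))
      hden.aemeasurable]
  refine lintegral_congr fun x => ?_
  have hx : Measurable fun n => f x (s x + n) :=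
    hf.comp (measurable_const.prodMk (measurable_const_add _))
  rw [gaussianReal_of_var_ne_zero 0 hv, lintegral_withDensity_eq_lintegral_mul _
    (measurable_gaussianPDF 0 v) hx,
    ← lintegral_add_right_eq_self (fun r => f x r * gaussianPDF 0 v (r - s x)) (s x)]
  refine lintegral_congr fun n => ?_
  simp [mul_comm, add_comm]

/-! ### A Gaussian source through a Gaussian channel -/

lemma integral_nonpos_of_lintegral_exp_le_one {α : Type*} [MeasurableSpace α] {μ : Measure α}
    [IsProbabilityMeasure μ] {f : α → ℝ} (hf : Integrable f μ)
    (h : ∫⁻ a, ENNReal.ofReal (Real.exp (f a)) ∂μ ≤ 1) : ∫ a, f a ∂μ ≤ 0 := by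
  have hexp_meas : AEStronglyMeasurable (fun a => Real.exp (f a)) μ :=
    Real.continuous_exp.comp_aestronglyMeasurable hf.aestronglyMeasurable
  have hexp_nonneg : ∀ a, 0 ≤ Real.exp (f a) := fun a => (Real.exp_pos _).le
  have hexp : Integrable (fun a => Real.exp (f a)) μ :=
    (lintegral_ofReal_ne_top_iff_integrable hexp_meas (ae_of_all _ hexp_nonneg)).1
      (ne_top_of_le_ne_top ENNReal.one_ne_top h)
  have hle : ∫ a, (f a + 1) ∂μ ≤ 1 :=
    calc ∫ a, (f a + 1) ∂μ
      _ ≤ ∫ a, Real.exp (f a) ∂μ :=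
        integral_mono (hf.add (integrable_const 1)) hexp fun a => Real.add_one_le_exp _
      _ ≤ 1 := by
        rw [← ENNReal.ofReal_le_one, ofReal_integral_eq_lintegral_ofReal hexp
          (ae_of_all _ hexp_nonneg)]
        exact h
  rw [integral_add hf (integrable_const 1)] at hle
  simpa using hle

/-- The logarithm of the density ratio, at source `z.1` and noise `z.2`, of two laws of the
source-output pair of a channel with signal `s`: in the competing law the output is
`𝒩(0, vr)` and the source given the output `r` is `𝒩(g r, τ)`, while in the actual law the source
is `𝒩(0, vx)` and the noise is `𝒩(0, vn)`. The normalizing constants cancel when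
`vx * vn = vr * τ`. -/
def channelLogRatio (vx vn vr τ : ℝ≥0) (s g : ℝ → ℝ) (z : ℝ × ℝ) : ℝ :=
  z.1 ^ 2 / (2 * vx) + z.2 ^ 2 / (2 * vn)
    - ((s z.1 + z.2) ^ 2 / (2 * vr) + (z.1 - g (s z.1 + z.2)) ^ 2 / (2 * τ))

lemma exp_mul_gaussianPDFReal_mul_gaussianPDFReal {vx vn vr τ : ℝ≥0} (h : vx * vn = vr * τ)
    (x n r m : ℝ) :
    Real.exp (x ^ 2 / (2 * vx) + n ^ 2 / (2 * vn) - (r ^ 2 / (2 * vr) + (x - m) ^ 2 / (2 * τ)))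
      * gaussianPDFReal 0 vx x * gaussianPDFReal 0 vn n =
      gaussianPDFReal 0 vr r * gaussianPDFReal m τ x := by
  have hconst : (√(2 * Real.pi * vx))⁻¹ * (√(2 * Real.pi * vn))⁻¹ =
      (√(2 * Real.pi * vr))⁻¹ * (√(2 * Real.pi * τ))⁻¹ := by
    have h' : (vx : ℝ) * vn = vr * τ := by exact_mod_cast h
    rw [← mul_inv, ← mul_inv, ← Real.sqrt_mul (by positivity), ← Real.sqrt_mul (by positivity)]
    congr 2
    linear_combination (2 * Real.pi) ^ 2 * h'
  simp only [gaussianPDFReal]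
  calc _ = ((√(2 * Real.pi * vx))⁻¹ * (√(2 * Real.pi * vn))⁻¹) *
        (Real.exp (x ^ 2 / (2 * vx) + n ^ 2 / (2 * vn)
            - (r ^ 2 / (2 * vr) + (x - m) ^ 2 / (2 * τ)))
          * Real.exp (-(x - 0) ^ 2 / (2 * vx)) * Real.exp (-(n - 0) ^ 2 / (2 * vn))) := by ring
    _ = ((√(2 * Real.pi * vr))⁻¹ * (√(2 * Real.pi * τ))⁻¹) *
        (Real.exp (-(r - 0) ^ 2 / (2 * vr)) * Real.exp (-(x - m) ^ 2 / (2 * τ))) := by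
      rw [hconst, ← Real.exp_add, ← Real.exp_add, ← Real.exp_add]
      ring_nf
    _ = _ := by ring

lemma lintegral_exp_channelLogRatio {vx vn vr τ : ℝ≥0} (hvx : vx ≠ 0) (hvn : vn ≠ 0)
    (hvr : vr ≠ 0) (hτ : τ ≠ 0) (h : vx * vn = vr * τ) {s g : ℝ → ℝ} (hs : Measurable s)
    (hg : Measurable g) :
    ∫⁻ z, ENNReal.ofReal (Real.exp (channelLogRatio vx vn vr τ s g z))
      ∂((gaussianReal 0 vx).prod (gaussianReal 0 vn)) = 1 := by
  set f : ℝ → ℝ → ℝ≥0∞ := fun x r => ENNReal.ofReal (Real.exp (x ^ 2 / (2 * vx)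
    + (r - s x) ^ 2 / (2 * vn) - (r ^ 2 / (2 * vr) + (x - g r) ^ 2 / (2 * τ)))) with hf_def
  have hf : Measurable (Function.uncurry f) := by
    unfold Function.uncurry f
    fun_prop
  have hfibre (r : ℝ) :
      ∫⁻ x, f x r * gaussianPDF 0 vn (r - s x) ∂(gaussianReal 0 vx) = gaussianPDF 0 vr r := by
    rw [gaussianReal_of_var_ne_zero 0 hvx, lintegral_withDensity_eq_lintegral_mul _
      (measurable_gaussianPDF 0 vx) (by fun_prop)]
    calc _ = ∫⁻ x, gaussianPDF 0 vr r * gaussianPDF (g r) τ x := by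
          refine lintegral_congr fun x => ?_
          simp only [Pi.mul_apply, gaussianPDF, hf_def]
          rw [← ENNReal.ofReal_mul (by positivity),
            ← ENNReal.ofReal_mul (gaussianPDFReal_nonneg _ _ _),
            ← ENNReal.ofReal_mul (gaussianPDFReal_nonneg _ _ _),
            ← exp_mul_gaussianPDFReal_mul_gaussianPDFReal h x (r - s x)]
          ring_nf
      _ = gaussianPDF 0 vr r := by
          rw [lintegral_const_mul _ (measurable_gaussianPDF _ _),
            lintegral_gaussianPDF_eq_one _ hτ, mul_one]
  have hchannel := lintegral_channel (gaussianReal 0 vx) hvn hs hf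
  rw [lintegral_congr hfibre, lintegral_gaussianPDF_eq_one 0 hvr] at hchannel
  simpa only [channelLogRatio, hf_def, add_sub_cancel_left] using hchannel

section Moments

variable {vx vn vr τ : ℝ≥0} {s g : ℝ → ℝ}

lemma integrable_channel_output_sq (hs : MemLp s 2 (gaussianReal 0 vx)) :
    Integrable (fun z : ℝ × ℝ => (s z.1 + z.2) ^ 2)
      ((gaussianReal 0 vx).prod (gaussianReal 0 vn)) :=
  ((hs.comp_fst _).add ((memLp_id_gaussianReal 2).comp_snd _)).integrable_sq

lemma integrable_channelLogRatio (hs : MemLp s 2 (gaussianReal 0 vx))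
    (hg : Integrable (fun z : ℝ × ℝ => (z.1 - g (s z.1 + z.2)) ^ 2)
      ((gaussianReal 0 vx).prod (gaussianReal 0 vn))) :
    Integrable (channelLogRatio vx vn vr τ s g)
      ((gaussianReal 0 vx).prod (gaussianReal 0 vn)) :=
  ((((memLp_id_gaussianReal 2).integrable_sq.comp_fst _).div_const _).add
    (((memLp_id_gaussianReal 2).integrable_sq.comp_snd _).div_const _)).sub
    (((integrable_channel_output_sq hs).div_const _).add (hg.div_const _))

lemma integral_channelLogRatio (hvx : vx ≠ 0) (hvn : vn ≠ 0) (hvr : vr ≠ 0)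
    (hs : MemLp s 2 (gaussianReal 0 vx)) (hsr : ∫ x, s x ^ 2 ∂(gaussianReal 0 vx) + vn = vr)
    (hg : Integrable (fun z : ℝ × ℝ => (z.1 - g (s z.1 + z.2)) ^ 2)
      ((gaussianReal 0 vx).prod (gaussianReal 0 vn))) :
    ∫ z, channelLogRatio vx vn vr τ s g z ∂((gaussianReal 0 vx).prod (gaussianReal 0 vn)) =
      (1 - (∫ z, (z.1 - g (s z.1 + z.2)) ^ 2
        ∂((gaussianReal 0 vx).prod (gaussianReal 0 vn))) / τ) / 2 := by
  set M := (gaussianReal 0 vx).prod (gaussianReal 0 vn)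
  have hx : Integrable (fun z : ℝ × ℝ => z.1 ^ 2 / (2 * (vx : ℝ))) M :=
    ((memLp_id_gaussianReal 2).integrable_sq.comp_fst _).div_const _
  have hn : Integrable (fun z : ℝ × ℝ => z.2 ^ 2 / (2 * (vn : ℝ))) M :=
    ((memLp_id_gaussianReal 2).integrable_sq.comp_snd _).div_const _
  have hr : Integrable (fun z : ℝ × ℝ => (s z.1 + z.2) ^ 2 / (2 * (vr : ℝ))) M :=
    (integrable_channel_output_sq hs).div_const _
  have hxn : Integrable (fun z : ℝ × ℝ => z.1 ^ 2 / (2 * (vx : ℝ)) + z.2 ^ 2 / (2 * (vn : ℝ))) M :=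
    hx.add hn
  have hrg : Integrable (fun z : ℝ × ℝ => (s z.1 + z.2) ^ 2 / (2 * (vr : ℝ))
      + (z.1 - g (s z.1 + z.2)) ^ 2 / (2 * (τ : ℝ))) M := hr.add (hg.div_const _)
  have hx_val : ∫ z, z.1 ^ 2 ∂M = vx := by
    rw [integral_fun_fst (fun x : ℝ => x ^ 2), integral_sq_gaussianReal]
    simp
  have hn_val : ∫ z, z.2 ^ 2 ∂M = vn := by
    rw [integral_fun_snd (fun n : ℝ => n ^ 2), integral_sq_gaussianReal]
    simp
  have hr_val : ∫ z, (s z.1 + z.2) ^ 2 ∂M = vr := by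
    rw [← hsr, ← integral_sq_gaussianReal vn]
    exact integral_sq_fst_add_snd hs (memLp_id_gaussianReal 2) integral_id_gaussianReal
  calc ∫ z, channelLogRatio vx vn vr τ s g z ∂M
    _ = vx / (2 * vx) + vn / (2 * vn)
        - (vr / (2 * vr) + (∫ z, (z.1 - g (s z.1 + z.2)) ^ 2 ∂M) / (2 * τ)) := by
      simp only [channelLogRatio]
      rw [integral_sub hxn hrg, integral_add hx hn, integral_add hr (hg.div_const _),
        integral_div, integral_div, integral_div, integral_div, hx_val, hn_val, hr_val]
    _ = _ := by
      field_simp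
      ring

end Moments

/-- Relative to the source-output law, the law of a Gaussian pair with the same output power has
total mass one, so by `integral_nonpos_of_lintegral_exp_le_one` its expected log-density ratio is
nonpositive; that ratio is affine in the squared error. -/
theorem le_channelError {vx vn : ℝ≥0} (hvx : vx ≠ 0) (hvn : vn ≠ 0) {s g : ℝ → ℝ}
    (hs : Measurable s) (hs₂ : MemLp s 2 (gaussianReal 0 vx)) (hg : Measurable g) :
    ENNReal.ofReal (vx * vn / (∫ x, s x ^ 2 ∂(gaussianReal 0 vx) + vn)) ≤
      channelError (gaussianReal 0 vx) vn s g := by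
  by_cases hfin : channelError (gaussianReal 0 vx) vn s g = ∞
  · simp [hfin]
  have hg₂ : Integrable (fun z : ℝ × ℝ => (z.1 - g (s z.1 + z.2)) ^ 2)
      ((gaussianReal 0 vx).prod (gaussianReal 0 vn)) :=
    (lintegral_ofReal_ne_top_iff_integrable (by fun_prop) (ae_of_all _ fun z => sq_nonneg _)).1 hfin
  obtain ⟨vr, hvr⟩ : ∃ vr : ℝ≥0, ∫ x, s x ^ 2 ∂(gaussianReal 0 vx) + vn = vr :=
    ⟨⟨_, add_nonneg (integral_nonneg fun x => sq_nonneg _) vn.2⟩, rfl⟩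
  have hvr₀ : vr ≠ 0 := by
    have : (vn : ℝ) ≤ vr := hvr ▸ le_add_of_nonneg_left (integral_nonneg fun x => sq_nonneg _)
    exact ((pos_iff_ne_zero.2 hvn).trans_le (by exact_mod_cast this)).ne'
  set τ : ℝ≥0 := vx * vn / vr with hτ
  have hτ₀ : 0 < (τ : ℝ) := NNReal.coe_pos.2 (by positivity)
  have hmass : vx * vn = vr * τ := by rw [hτ, mul_div_cancel₀ _ hvr₀]
  have hgibbs := integral_nonpos_of_lintegral_exp_le_one (integrable_channelLogRatio hs₂ hg₂)
    (lintegral_exp_channelLogRatio hvx hvn hvr₀ (by positivity) hmass hs hg).le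
  rw [integral_channelLogRatio hvx hvn hvr₀ hs₂ hvr hg₂] at hgibbs
  rw [channelError, ← ofReal_integral_eq_lintegral_ofReal hg₂ (ae_of_all _ fun z => sq_nonneg _),
    hvr, show (vx * vn / vr : ℝ) = τ by simp [hτ]]
  refine ENNReal.ofReal_le_ofReal ((one_le_div hτ₀).1 ?_)
  linarith

/-! ### Optimal estimators -/

lemma gaussianPDFReal_le_inv_sqrt {c v : ℝ≥0} (hc : 0 < c) (h : c ≤ v) (m x : ℝ) :
    gaussianPDFReal m v x ≤ (√(2 * Real.pi * c))⁻¹ := by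
  have hexp : Real.exp (-(x - m) ^ 2 / (2 * v)) ≤ 1 :=
    Real.exp_le_one_iff.2 (div_nonpos_of_nonpos_of_nonneg (neg_nonpos.2 (sq_nonneg _))
      (by positivity))
  calc gaussianPDFReal m v x
    _ ≤ (√(2 * Real.pi * v))⁻¹ * 1 := by
      rw [gaussianPDFReal]
      gcongr
    _ ≤ (√(2 * Real.pi * c))⁻¹ := by
      rw [mul_one]
      gcongr

lemma continuousAt_gaussianPDFReal {T : Type*} [TopologicalSpace T] {v : T → ℝ≥0} {f : T → ℝ}
    {t : T} (m : ℝ) (hvt : v t ≠ 0) (hv : ContinuousAt v t) (hf : ContinuousAt f t) :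
    ContinuousAt (fun t => gaussianPDFReal m (v t) (f t)) t := by
  have hv' : ContinuousAt (fun t => (v t : ℝ)) t := by fun_prop
  unfold gaussianPDFReal
  exact ((by fun_prop : ContinuousAt (fun t => √(2 * Real.pi * v t)) t).inv₀ (by positivity)).mul
    (Real.continuous_exp.continuousAt.comp
      (ContinuousAt.div (by fun_prop) (by fun_prop) (by positivity)))

/-- The unnormalized posterior moment of order `k` of a source with law `μ`, given the output `r`
of the channel with signal `s` and noise variance `v`. Order `0` gives the density of the
output. -/
def posteriorMoment (μ : Measure ℝ) (v : ℝ≥0) (s : ℝ → ℝ) (k : ℕ) (r : ℝ) : ℝ :=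
  ∫ x, x ^ k * gaussianPDFReal 0 v (r - s x) ∂μ

/-- The posterior mean of the source, given the channel output `r`. -/
def posteriorMean (μ : Measure ℝ) (v : ℝ≥0) (s : ℝ → ℝ) (r : ℝ) : ℝ :=
  posteriorMoment μ v s 1 r / posteriorMoment μ v s 0 r

/-- The posterior variance of the source given the channel output `r`, times the density of the
output at `r`. -/
def posteriorSpread (μ : Measure ℝ) (v : ℝ≥0) (s : ℝ → ℝ) (r : ℝ) : ℝ :=
  posteriorMoment μ v s 2 r - posteriorMoment μ v s 1 r ^ 2 / posteriorMoment μ v s 0 r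

section Measurability

variable {μ : Measure ℝ} [SFinite μ] {v : ℝ≥0} {s : ℝ → ℝ}

lemma measurable_posteriorMoment (hs : Measurable s) (k : ℕ) :
    Measurable (posteriorMoment μ v s k) := by
  refine StronglyMeasurable.measurable (StronglyMeasurable.integral_prod_right (ν := μ)
    (f := fun r x => x ^ k * gaussianPDFReal 0 v (r - s x)) (Measurable.stronglyMeasurable ?_))
  unfold Function.uncurry
  fun_prop

lemma measurable_posteriorMean (hs : Measurable s) : Measurable (posteriorMean μ v s) :=
  (measurable_posteriorMoment hs 1).div (measurable_posteriorMoment hs 0)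

lemma measurable_posteriorSpread (hs : Measurable s) : Measurable (posteriorSpread μ v s) :=
  (measurable_posteriorMoment hs 2).sub
    (((measurable_posteriorMoment hs 1).pow_const 2).div (measurable_posteriorMoment hs 0))

end Measurability

lemma integrable_mul_gaussianPDFReal {μ : Measure ℝ} {f : ℝ → ℝ} (hf : Integrable f μ) {v : ℝ≥0}
    (hv : v ≠ 0) {s : ℝ → ℝ} (hs : Measurable s) (r : ℝ) :
    Integrable (fun x => f x * gaussianPDFReal 0 v (r - s x)) μ := by
  refine hf.mul_bdd (c := (√(2 * Real.pi * v))⁻¹)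
    (Measurable.aestronglyMeasurable (by fun_prop)) (ae_of_all _ fun x => ?_)
  rw [Real.norm_of_nonneg (gaussianPDFReal_nonneg _ _ _)]
  exact gaussianPDFReal_le_inv_sqrt (pos_iff_ne_zero.2 hv) le_rfl _ _

lemma channelError_zero_ne_top {μ : Measure ℝ} (hμ : MemLp id 2 μ) (v : ℝ≥0) (s : ℝ → ℝ) :
    channelError μ v s 0 ≠ ∞ := by
  have hsq : Integrable (fun z : ℝ × ℝ => z.1 ^ 2) (μ.prod (gaussianReal 0 v)) :=
    hμ.integrable_sq.comp_fst _
  simpa [channelError] using (lintegral_ofReal_ne_top_iff_integrable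
    hsq.aestronglyMeasurable (ae_of_all _ fun z => sq_nonneg _)).2 hsq

section Posterior

variable {μ : Measure ℝ} [IsProbabilityMeasure μ] {v : ℝ≥0} {s g : ℝ → ℝ}

lemma integrable_pow_of_memLp_two (hμ : MemLp id 2 μ) {k : ℕ} (hk : k ≤ 2) :
    Integrable (fun x => x ^ k) μ := by
  have hk' : MemLp id (k : ℝ≥0∞) μ := hμ.mono_exponent (by exact_mod_cast hk)
  exact hk'.integrable_norm_pow'.mono (by fun_prop) (ae_of_all _ fun x => by simp)

lemma posteriorMoment_zero_pos (hv : v ≠ 0) (hs : Measurable s) (r : ℝ) :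
    0 < posteriorMoment μ v s 0 r := by
  have hpos : ∀ x, 0 < x ^ 0 * gaussianPDFReal 0 v (r - s x) := fun x => by
    simpa using gaussianPDFReal_pos 0 v _ hv
  refine (integral_pos_iff_support_of_nonneg (fun x => (hpos x).le)
    (integrable_mul_gaussianPDFReal (by simp) hv hs r)).2 ?_
  rw [show Function.support _ = Set.univ from Set.eq_univ_of_forall fun x => (hpos x).ne']
  simp

lemma integral_sq_sub_mul_gaussianPDFReal (hμ : MemLp id 2 μ) (hv : v ≠ 0) (hs : Measurable s)
    (r y : ℝ) :
    ∫ x, (x - y) ^ 2 * gaussianPDFReal 0 v (r - s x) ∂μ =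
      posteriorSpread μ v s r + posteriorMoment μ v s 0 r * (y - posteriorMean μ v s r) ^ 2 := by
  have hint (k : ℕ) (hk : k ≤ 2) := integrable_mul_gaussianPDFReal
    (integrable_pow_of_memLp_two hμ hk) hv hs r
  have h₀ := (hint 0 (by norm_num)).const_mul (y ^ 2)
  have h₁ := (hint 1 (by norm_num)).const_mul (2 * y)
  have h₂₁ : Integrable (fun x => x ^ 2 * gaussianPDFReal 0 v (r - s x)
      - 2 * y * (x ^ 1 * gaussianPDFReal 0 v (r - s x))) μ := (hint 2 le_rfl).sub h₁
  have hmoments : ∫ x, (x - y) ^ 2 * gaussianPDFReal 0 v (r - s x) ∂μ =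
      posteriorMoment μ v s 2 r - 2 * y * posteriorMoment μ v s 1 r
        + y ^ 2 * posteriorMoment μ v s 0 r := by
    simp only [posteriorMoment]
    rw [← integral_const_mul, ← integral_const_mul, ← integral_sub (hint 2 le_rfl) h₁,
      ← integral_add h₂₁ h₀]
    congr with x
    ring
  have hpos := posteriorMoment_zero_pos (μ := μ) hv hs r
  rw [hmoments, posteriorSpread, posteriorMean]
  field_simp
  ring

lemma posteriorSpread_nonneg (hμ : MemLp id 2 μ) (hv : v ≠ 0) (hs : Measurable s) (r : ℝ) :
    0 ≤ posteriorSpread μ v s r := by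
  have h := integral_sq_sub_mul_gaussianPDFReal hμ hv hs r (posteriorMean μ v s r)
  rw [sub_self, zero_pow two_ne_zero, mul_zero, add_zero] at h
  exact h ▸ integral_nonneg fun x => mul_nonneg (sq_nonneg _) (gaussianPDFReal_nonneg _ _ _)

lemma channelError_eq_lintegral_posterior (hμ : MemLp id 2 μ) (hv : v ≠ 0) (hs : Measurable s)
    (hg : Measurable g) :
    channelError μ v s g = ∫⁻ r, ENNReal.ofReal (posteriorSpread μ v s r) +
      ENNReal.ofReal (posteriorMoment μ v s 0 r * (g r - posteriorMean μ v s r) ^ 2) := by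
  rw [channelError, lintegral_channel _ hv hs (f := fun x r => ENNReal.ofReal ((x - g r) ^ 2))
    (by unfold Function.uncurry; fun_prop)]
  refine lintegral_congr fun r => ?_
  have hsq : Integrable (fun x => (x - g r) ^ 2) μ := (hμ.sub (memLp_const (g r))).integrable_sq
  rw [← ENNReal.ofReal_add (posteriorSpread_nonneg hμ hv hs r)
    (mul_nonneg (posteriorMoment_zero_pos hv hs r).le (sq_nonneg _)),
    ← integral_sq_sub_mul_gaussianPDFReal hμ hv hs, ofReal_integral_eq_lintegral_ofReal
    (integrable_mul_gaussianPDFReal hsq hv hs r) (ae_of_all _ fun x =>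
      mul_nonneg (sq_nonneg _) (gaussianPDFReal_nonneg _ _ _))]
  simp only [gaussianPDF, ENNReal.ofReal_mul (sq_nonneg _)]

lemma channelError_posteriorMean (hμ : MemLp id 2 μ) (hv : v ≠ 0) (hs : Measurable s) :
    channelError μ v s (posteriorMean μ v s) =
      ∫⁻ r, ENNReal.ofReal (posteriorSpread μ v s r) := by
  simp [channelError_eq_lintegral_posterior hμ hv hs (measurable_posteriorMean hs)]

lemma channelError_eq_channelError_posteriorMean_add (hμ : MemLp id 2 μ) (hv : v ≠ 0)
    (hs : Measurable s) (hg : Measurable g) :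
    channelError μ v s g = channelError μ v s (posteriorMean μ v s) +
      ∫⁻ r, ENNReal.ofReal (posteriorMoment μ v s 0 r * (g r - posteriorMean μ v s r) ^ 2) := by
  rw [channelError_eq_lintegral_posterior hμ hv hs hg, channelError_posteriorMean hμ hv hs,
    lintegral_add_left (measurable_posteriorSpread hs).ennreal_ofReal]

lemma channelError_posteriorMean_le (hμ : MemLp id 2 μ) (hv : v ≠ 0) (hs : Measurable s)
    (hg : Measurable g) : channelError μ v s (posteriorMean μ v s) ≤ channelError μ v s g :=
  channelError_eq_channelError_posteriorMean_add hμ hv hs hg ▸ le_self_add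

theorem ae_eq_posteriorMean_of_channelError_le (hμ : MemLp id 2 μ) (hv : v ≠ 0)
    (hs : Measurable s) (hg : Measurable g)
    (hle : channelError μ v s g ≤ channelError μ v s (posteriorMean μ v s)) :
    g =ᵐ[volume] posteriorMean μ v s := by
  have hfin : channelError μ v s (posteriorMean μ v s) ≠ ∞ :=
    ne_top_of_le_ne_top (channelError_zero_ne_top hμ v s)
      (channelError_posteriorMean_le hμ hv hs measurable_zero)
  rw [channelError_eq_channelError_posteriorMean_add hμ hv hs hg] at hle
  have hzero := nonpos_iff_eq_zero.1 (ENNReal.le_of_add_le_add_left hfin (by simpa using hle))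
  have hmeas : Measurable fun r =>
      ENNReal.ofReal (posteriorMoment μ v s 0 r * (g r - posteriorMean μ v s r) ^ 2) :=
    ((measurable_posteriorMoment hs 0).mul
      ((hg.sub (measurable_posteriorMean hs)).pow_const 2)).ennreal_ofReal
  filter_upwards [(lintegral_eq_zero_iff hmeas).1 hzero] with r hr
  by_contra hne
  have hden := posteriorMoment_zero_pos (μ := μ) hv hs r
  exact (ENNReal.ofReal_pos.2 (by positivity)).ne' hr

end Posterior

section Parametrized

variable {T : Type*} [TopologicalSpace T] [FirstCountableTopology T] {μ : Measure ℝ}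
  {v : T → ℝ≥0} {s : T → ℝ → ℝ}

lemma continuous_posteriorMoment {k : ℕ} (hk : Integrable (fun x => x ^ k) μ) (hv : Continuous v)
    (hv₀ : ∀ t, v t ≠ 0) (hs : ∀ t, Measurable (s t)) (hsc : ∀ x, Continuous fun t => s t x)
    (r : ℝ) : Continuous fun t => posteriorMoment μ (v t) (s t) k r := by
  refine continuous_iff_continuousAt.2 fun t => ?_
  have hhalf : v t / 2 < v t := half_lt_self (pos_iff_ne_zero.2 (hv₀ t))
  refine continuousAt_of_dominated
    (bound := fun x => ‖x ^ k‖ * (√(2 * Real.pi * ((v t / 2 : ℝ≥0) : ℝ)))⁻¹)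
    (Eventually.of_forall fun t' => ?_) ?_ (hk.norm.mul_const _) (ae_of_all _ fun x => ?_)
  · exact (integrable_mul_gaussianPDFReal hk (hv₀ t') (hs t') r).aestronglyMeasurable
  · filter_upwards [hv.continuousAt.eventually_const_lt hhalf] with t' ht'
    refine ae_of_all _ fun x => ?_
    rw [norm_mul, Real.norm_of_nonneg (gaussianPDFReal_nonneg _ _ _)]
    gcongr
    exact gaussianPDFReal_le_inv_sqrt (half_pos (pos_iff_ne_zero.2 (hv₀ t))) ht'.le _ _
  · exact continuousAt_const.mul (continuousAt_gaussianPDFReal 0 (hv₀ t) hv.continuousAt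
      (continuousAt_const.sub (hsc x).continuousAt))

variable [IsProbabilityMeasure μ]

lemma continuous_posteriorSpread (hμ : MemLp id 2 μ) (hv : Continuous v)
    (hv₀ : ∀ t, v t ≠ 0) (hs : ∀ t, Measurable (s t)) (hsc : ∀ x, Continuous fun t => s t x)
    (r : ℝ) : Continuous fun t => posteriorSpread μ (v t) (s t) r := by
  have hmoment (k : ℕ) (hk : k ≤ 2) := continuous_posteriorMoment
    (integrable_pow_of_memLp_two hμ hk) hv hv₀ hs hsc r
  exact (hmoment 2 le_rfl).sub (((hmoment 1 (by norm_num)).pow 2).div (hmoment 0 (by norm_num))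
    fun t => (posteriorMoment_zero_pos (hv₀ t) (hs t) r).ne')

lemma lowerSemicontinuous_channelError_posteriorMean (hμ : MemLp id 2 μ) (hv : Continuous v)
    (hv₀ : ∀ t, v t ≠ 0) (hs : ∀ t, Measurable (s t)) (hsc : ∀ x, Continuous fun t => s t x) :
    LowerSemicontinuous fun t =>
      channelError μ (v t) (s t) (posteriorMean μ (v t) (s t)) := by
  simp only [fun t => channelError_posteriorMean hμ (hv₀ t) (hs t)]
  refine lowerSemicontinuous_iff_le_liminf.2 fun t => ?_
  calc ∫⁻ r, ENNReal.ofReal (posteriorSpread μ (v t) (s t) r)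
    _ = ∫⁻ r, liminf (fun t' => ENNReal.ofReal (posteriorSpread μ (v t') (s t') r)) (𝓝 t) :=
      lintegral_congr fun r => ((ENNReal.continuous_ofReal.comp
        (continuous_posteriorSpread hμ hv hv₀ hs hsc r)).tendsto t).liminf_eq.symm
    _ ≤ _ := lintegral_liminf_le fun t' => (measurable_posteriorSpread (hs t')).ennreal_ofReal

theorem exists_channelError_le (hμ : MemLp id 2 μ) (hv : Continuous v)
    (hv₀ : ∀ t, v t ≠ 0) (hs : ∀ t, Measurable (s t)) (hsc : ∀ x, Continuous fun t => s t x)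
    {I : Set T} (hI : IsCompact I) (hne : I.Nonempty) :
    ∃ t ∈ I, ∃ g : ℝ → ℝ, Measurable g ∧ ∀ t' ∈ I, ∀ g' : ℝ → ℝ, Measurable g' →
      channelError μ (v t) (s t) g ≤ channelError μ (v t') (s t') g' := by
  obtain ⟨t, ht, hmin⟩ := LowerSemicontinuousOn.exists_isMinOn hne hI
    ((lowerSemicontinuous_channelError_posteriorMean hμ hv hv₀ hs hsc).lowerSemicontinuousOn I)
  exact ⟨t, ht, posteriorMean μ (v t) (s t), measurable_posteriorMean (hs t),
    fun t' ht' g' hg' => (hmin ht').trans (channelError_posteriorMean_le hμ (hv₀ t') (hs t') hg')⟩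

end Parametrized

/-! ### The game as a channel -/

/-- The variance of the combined noise `α * v + (1 - α) * w`, for noises `v` and `w` of variances
`vv` and `vw`. -/
def noiseVar (vv vw : ℝ≥0) (α : ℝ) : ℝ≥0 :=
  Real.toNNReal (α ^ 2) * vv + Real.toNNReal ((1 - α) ^ 2) * vw

/-- The noiseless part of the decoder input, as a function of the source. -/
def combinedSignal (γ : Encoder) (α x : ℝ) : ℝ := α * γ.message x + (1 - α) * x

lemma coe_noiseVar (vv vw : ℝ≥0) (α : ℝ) :
    (noiseVar vv vw α : ℝ) = α ^ 2 * vv + (1 - α) ^ 2 * vw := by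
  simp [noiseVar, sq_nonneg]

lemma noiseVar_ne_zero {vv vw : ℝ≥0} (hvv : 0 < vv) (hvw : 0 < vw) (α : ℝ) :
    noiseVar vv vw α ≠ 0 := by
  rw [← NNReal.coe_ne_zero, coe_noiseVar]
  rcases eq_or_ne α 0 with rfl | hα
  · simpa using hvw.ne'
  · positivity

lemma continuous_noiseVar (vv vw : ℝ≥0) : Continuous (noiseVar vv vw) := by
  unfold noiseVar
  fun_prop

lemma measurable_combinedSignal (γ : Encoder) (α : ℝ) : Measurable (combinedSignal γ α) :=
  (γ.measurable_message.const_mul α).add (measurable_const_mul (1 - α))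

lemma continuous_combinedSignal (γ : Encoder) (x : ℝ) :
    Continuous fun α => combinedSignal γ α x := by
  unfold combinedSignal
  fun_prop

section Game

variable {Ω : Type*} [MeasurableSpace Ω] {P : Measure Ω} {X V W : Ω → ℝ}

/-- The probabilistic model of the game: the source and the noises of the two channels are
independent centred Gaussian variables, described by their variances. -/
structure IsGaussianModel (P : Measure Ω) (X V W : Ω → ℝ) (vx vv vw : ℝ≥0) : Prop where
  hasLaw_source : HasLaw X (gaussianReal 0 vx) P
  hasLaw_encoderNoise : HasLaw V (gaussianReal 0 vv) P
  hasLaw_sideNoise : HasLaw W (gaussianReal 0 vw) P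
  iIndepFun : iIndepFun ![X, V, W] P

section Model

variable {vx vv vw : ℝ≥0} {γ : Encoder} {d : Decoder}

lemma IsGaussianModel.isProbabilityMeasure (h : IsGaussianModel P X V W vx vv vw) :
    IsProbabilityMeasure P :=
  h.hasLaw_source.isProbabilityMeasure

lemma IsGaussianModel.hasLaw_combinedNoise (h : IsGaussianModel P X V W vx vv vw) (α : ℝ) :
    HasLaw (fun ω => α * V ω + (1 - α) * W ω) (gaussianReal 0 (noiseVar vv vw α)) P := by
  have hVW : IndepFun V W P := h.iIndepFun.indepFun (i := 1) (j := 2) (by decide)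
  have hscaled : IndepFun (fun ω => α * V ω) (fun ω => (1 - α) * W ω) P :=
    hVW.comp (measurable_const_mul α) (measurable_const_mul (1 - α))
  refine ⟨(h.hasLaw_encoderNoise.aemeasurable.const_mul α).add
    (h.hasLaw_sideNoise.aemeasurable.const_mul (1 - α)), ?_⟩
  refine (gaussianReal_add_gaussianReal_of_indepFun hscaled
    (gaussianReal_const_mul h.hasLaw_encoderNoise α).map_eq
    (gaussianReal_const_mul h.hasLaw_sideNoise (1 - α)).map_eq).trans ?_
  congr 1
  · simp
  · ext
    simp [coe_noiseVar]

lemma IsGaussianModel.hasLaw_source_combinedNoise (h : IsGaussianModel P X V W vx vv vw) (α : ℝ) :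
    HasLaw (fun ω => (X ω, α * V ω + (1 - α) * W ω))
      ((gaussianReal 0 vx).prod (gaussianReal 0 (noiseVar vv vw α))) P := by
  have := h.isProbabilityMeasure
  have hmeas (i : Fin 3) : AEMeasurable (![X, V, W] i) P := by
    fin_cases i
    exacts [h.hasLaw_source.aemeasurable, h.hasLaw_encoderNoise.aemeasurable,
      h.hasLaw_sideNoise.aemeasurable]
  have hpair : IndepFun (fun ω => (V ω, W ω)) X P :=
    h.iIndepFun.indepFun_prodMk₀ hmeas 1 2 0 (by decide) (by decide)
  have hnoise : IndepFun X (fun ω => α * V ω + (1 - α) * W ω) P :=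
    hpair.symm.comp (φ := id) (ψ := fun z : ℝ × ℝ => α * z.1 + (1 - α) * z.2) measurable_id
      (by fun_prop)
  exact (indepFun_iff_hasLaw_prodMk_prod h.hasLaw_source (h.hasLaw_combinedNoise α)).1 hnoise

lemma IsGaussianModel.decoderCost_eq_channelError (h : IsGaussianModel P X V W vx vv vw)
    (γ : Encoder) (d : Decoder) :
    decoderCost P X V W γ d = channelError (gaussianReal 0 vx) (noiseVar vv vw d.ratio)
      (combinedSignal γ d.ratio) d.estimate := by
  have hd := d.measurable_estimate
  have hs := measurable_combinedSignal γ d.ratio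
  rw [channelError, ← (h.hasLaw_source_combinedNoise d.ratio).lintegral_comp (by fun_prop)]
  refine lintegral_congr fun ω => ?_
  simp only [reconstruction, received, combinedSignal]
  ring_nf

lemma IsGaussianModel.exists_isBestResponse (h : IsGaussianModel P X V W vx vv vw)
    (hvv : 0 < vv) (hvw : 0 < vw) (γ : Encoder) : ∃ d : Decoder, IsBestResponse P X V W γ d := by
  obtain ⟨α, hα, g, hg, hmin⟩ := exists_channelError_le (memLp_id_gaussianReal (v := vx) 2)
    (continuous_noiseVar vv vw) (noiseVar_ne_zero hvv hvw) (measurable_combinedSignal γ)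
    (continuous_combinedSignal γ) (isCompact_Icc (a := (0 : ℝ)) (b := 1))
    (Set.nonempty_Icc.2 zero_le_one)
  refine ⟨⟨α, hα, g, hg⟩, fun d' => ?_⟩
  rw [h.decoderCost_eq_channelError, h.decoderCost_eq_channelError]
  exact hmin d'.ratio d'.ratio_mem d'.estimate d'.measurable_estimate

lemma IsBestResponse.estimate_ae_eq_posteriorMean (hd : IsBestResponse P X V W γ d)
    (h : IsGaussianModel P X V W vx vv vw) (hvv : 0 < vv) (hvw : 0 < vw) :
    d.estimate =ᵐ[volume] posteriorMean (gaussianReal 0 vx) (noiseVar vv vw d.ratio)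
      (combinedSignal γ d.ratio) := by
  have hs := measurable_combinedSignal γ d.ratio
  have hle := hd ⟨d.ratio, d.ratio_mem, _,
    measurable_posteriorMean (μ := gaussianReal 0 vx) (v := noiseVar vv vw d.ratio) hs⟩
  rw [h.decoderCost_eq_channelError, h.decoderCost_eq_channelError] at hle
  exact ae_eq_posteriorMean_of_channelError_le (memLp_id_gaussianReal 2)
    (noiseVar_ne_zero hvv hvw d.ratio) hs d.measurable_estimate hle

end Model

/-! ### Best responses are unbiased -/

lemma integral_sub_const_sq {μ : Measure Ω} [IsProbabilityMeasure μ] {f : Ω → ℝ}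
    (hf : MemLp f 2 μ) (c : ℝ) :
    ∫ ω, (f ω - c) ^ 2 ∂μ = ∫ ω, f ω ^ 2 ∂μ - 2 * c * ∫ ω, f ω ∂μ + c ^ 2 := by
  have hlin : Integrable (fun ω => 2 * c * f ω) μ := (hf.integrable one_le_two).const_mul _
  calc ∫ ω, (f ω - c) ^ 2 ∂μ
    _ = ∫ ω, (f ω ^ 2 - 2 * c * f ω + c ^ 2) ∂μ := by
      congr with ω
      ring
    _ = ∫ ω, (f ω ^ 2 - 2 * c * f ω) ∂μ + ∫ _, c ^ 2 ∂μ :=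
      integral_add (hf.integrable_sq.sub hlin) (integrable_const _)
    _ = _ := by
      rw [integral_sub hf.integrable_sq hlin, integral_const_mul]
      simp

lemma aemeasurable_reconstruction (hX : AEMeasurable X P) (hV : AEMeasurable V P)
    (hW : AEMeasurable W P) (γ : Encoder) (d : Decoder) :
    AEMeasurable (reconstruction X V W γ d) P :=
  d.measurable_estimate.comp_aemeasurable
    ((((γ.measurable_message.comp_aemeasurable hX).add hV).const_mul _).add
      ((hX.add hW).const_mul _))

section Unbiased

variable {γ : Encoder} {d : Decoder} (hd : IsBestResponse P X V W γ d) (hX : MemLp X 2 P)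
  (hV : AEMeasurable V P) (hW : AEMeasurable W P)

include hd hX

lemma IsBestResponse.decoderCost_ne_top : decoderCost P X V W γ d ≠ ∞ := by
  refine ne_top_of_le_ne_top ?_ (hd ⟨0, by simp, 0, measurable_zero⟩)
  simpa [decoderCost, reconstruction] using (lintegral_ofReal_ne_top_iff_integrable
    hX.integrable_sq.aestronglyMeasurable (ae_of_all _ fun ω => sq_nonneg _)).2 hX.integrable_sq

include hV hW

lemma IsBestResponse.memLp_error : MemLp (fun ω => X ω - reconstruction X V W γ d ω) 2 P := by
  have hmeas : AEStronglyMeasurable (fun ω => X ω - reconstruction X V W γ d ω) P :=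
    hX.aestronglyMeasurable.sub
      (aemeasurable_reconstruction hX.aemeasurable hV hW γ d).aestronglyMeasurable
  exact (memLp_two_iff_integrable_sq hmeas).2 ((lintegral_ofReal_ne_top_iff_integrable
    (hmeas.pow 2) (ae_of_all _ fun ω => sq_nonneg _)).1 (hd.decoderCost_ne_top hX))

variable [IsProbabilityMeasure P]

lemma IsBestResponse.integral_error_eq_zero :
    ∫ ω, (X ω - reconstruction X V W γ d ω) ∂P = 0 := by
  have he := hd.memLp_error hX hV hW
  set e : Ω → ℝ := fun ω => X ω - reconstruction X V W γ d ω
  set m : ℝ := ∫ ω, e ω ∂P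
  have hshift : decoderCost P X V W γ ⟨d.ratio, d.ratio_mem, fun r => d.estimate r + m,
      d.measurable_estimate.add_const m⟩ = ∫⁻ ω, ENNReal.ofReal ((e ω - m) ^ 2) ∂P := by
    refine lintegral_congr fun ω => ?_
    simp only [reconstruction, e]
    ring_nf
  have hle : ∫⁻ ω, ENNReal.ofReal (e ω ^ 2) ∂P ≤ ∫⁻ ω, ENNReal.ofReal ((e ω - m) ^ 2) ∂P :=
    hshift ▸ hd _
  have hem : Integrable (fun ω => (e ω - m) ^ 2) P := (he.sub (memLp_const m)).integrable_sq
  rw [← ofReal_integral_eq_lintegral_ofReal he.integrable_sq (ae_of_all _ fun ω => sq_nonneg _),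
    ← ofReal_integral_eq_lintegral_ofReal hem (ae_of_all _ fun ω => sq_nonneg _),
    ENNReal.ofReal_le_ofReal_iff (integral_nonneg fun ω => sq_nonneg _)] at hle
  have hle' := hle.trans_eq (integral_sub_const_sq he m)
  have hm : m ^ 2 ≤ 0 := by linarith
  exact pow_eq_zero_iff two_ne_zero |>.1 (le_antisymm hm (sq_nonneg m))

lemma IsBestResponse.lintegral_error_sub_sq (b : ℝ) :
    ∫⁻ ω, ENNReal.ofReal ((X ω - reconstruction X V W γ d ω - b) ^ 2) ∂P =
      decoderCost P X V W γ d + ENNReal.ofReal (b ^ 2) := by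
  have he := hd.memLp_error hX hV hW
  have heb : Integrable (fun ω => (X ω - reconstruction X V W γ d ω - b) ^ 2) P :=
    (he.sub (memLp_const b)).integrable_sq
  rw [decoderCost, ← ofReal_integral_eq_lintegral_ofReal heb (ae_of_all _ fun ω => sq_nonneg _),
    ← ofReal_integral_eq_lintegral_ofReal he.integrable_sq (ae_of_all _ fun ω => sq_nonneg _),
    integral_sub_const_sq he, hd.integral_error_eq_zero hX hV hW, mul_zero, sub_zero,
    ENNReal.ofReal_add (integral_nonneg fun ω => sq_nonneg _) (sq_nonneg b)]

lemma IsBestResponse.encoderCost_eq {θ : ℝ} (hθ : 0 ≤ θ) (b : ℝ) :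
    encoderCost P X V W b θ γ d = decoderCost P X V W γ d + ENNReal.ofReal (b ^ 2) +
      ∫⁻ ω, ENNReal.ofReal (θ * γ.message (X ω) ^ 2) ∂P := by
  have hmeas : AEMeasurable (fun ω => γ.message (X ω)) P :=
    γ.measurable_message.comp_aemeasurable hX.aemeasurable
  rw [← hd.lintegral_error_sub_sq hX hV hW, ← lintegral_add_right' _ (by fun_prop)]
  refine lintegral_congr fun ω => ?_
  rw [ENNReal.ofReal_add (sq_nonneg _) (mul_nonneg hθ (sq_nonneg _))]

end Unbiased

/-- The transmit power of an encoder, for a source with law `μ`. -/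
def Encoder.power (γ : Encoder) (μ : Measure ℝ) : ℝ := ∫ x, γ.message x ^ 2 ∂μ

lemma Encoder.power_nonneg (γ : Encoder) (μ : Measure ℝ) : 0 ≤ γ.power μ :=
  integral_nonneg fun _ => sq_nonneg _

lemma memLp_two_of_hasLaw {μ : Measure ℝ} (hX : HasLaw X μ P) (hμ : MemLp id 2 μ) :
    MemLp X 2 P :=
  MemLp.comp_of_map (g := id) (hX.map_eq ▸ hμ) hX.aemeasurable

section Power

variable {μ : Measure ℝ} {θ : ℝ} {γ : Encoder} {d : Decoder} [IsProbabilityMeasure P]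

lemma IsBestResponse.memLp_message (hd : IsBestResponse P X V W γ d) (hX : HasLaw X μ P)
    (hμ : MemLp id 2 μ) (hV : AEMeasurable V P) (hW : AEMeasurable W P) (hθ : 0 < θ) {b : ℝ}
    (hfin : encoderCost P X V W b θ γ d ≠ ∞) : MemLp γ.message 2 μ := by
  have hmeas := γ.measurable_message
  rw [hd.encoderCost_eq (memLp_two_of_hasLaw hX hμ) hV hW hθ.le,
    hX.lintegral_comp (f := fun x => ENNReal.ofReal (θ * γ.message x ^ 2)) (by fun_prop)] at hfin
  have hint : Integrable (fun x => θ * γ.message x ^ 2) μ :=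
    (lintegral_ofReal_ne_top_iff_integrable (by fun_prop)
      (ae_of_all _ fun x => mul_nonneg hθ.le (sq_nonneg _))).1 (ENNReal.add_ne_top.1 hfin).2
  exact (memLp_two_iff_integrable_sq hmeas.aestronglyMeasurable).2
    ((integrable_const_mul_iff hθ.ne'.isUnit _).1 hint)

lemma IsBestResponse.encoderCost_eq_ofReal (hd : IsBestResponse P X V W γ d) (hX : HasLaw X μ P)
    (hμ : MemLp id 2 μ) (hV : AEMeasurable V P) (hW : AEMeasurable W P) (hθ : 0 ≤ θ) (b : ℝ)
    (hγ : MemLp γ.message 2 μ) :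
    encoderCost P X V W b θ γ d =
      ENNReal.ofReal ((decoderCost P X V W γ d).toReal + θ * γ.power μ + b ^ 2) := by
  have hmeas := γ.measurable_message
  have hX₂ := memLp_two_of_hasLaw hX hμ
  have hpower := mul_nonneg hθ (γ.power_nonneg μ)
  rw [hd.encoderCost_eq hX₂ hV hW hθ,
    hX.lintegral_comp (f := fun x => ENNReal.ofReal (θ * γ.message x ^ 2)) (by fun_prop),
    ← ofReal_integral_eq_lintegral_ofReal (hγ.integrable_sq.const_mul θ)
      (ae_of_all _ fun x => mul_nonneg hθ (sq_nonneg _)), integral_const_mul,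
    ENNReal.ofReal_add (by positivity) (sq_nonneg b),
    ENNReal.ofReal_add ENNReal.toReal_nonneg hpower,
    ENNReal.ofReal_toReal (hd.decoderCost_ne_top hX₂), add_right_comm]
  rfl

end Power
end Game

/-! ### Maximal ratio combining -/

/-- The least mean square error with which a decoder can estimate a source of variance `vx` from
a message of power `p` received in noise of variance `vv`, combined with the source itself
received in noise of variance `vw`. -/
def minError (vx vv vw p : ℝ) : ℝ := vx / (1 + vx / vw + p / vv)

/-- The combining ratio that is optimal for a linear encoder of gain `A`: the signal to noise
ratio of the combination is largest when each channel has weight proportional to its gain and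
inversely proportional to its noise variance. -/
def matchedRatio (vv vw A : ℝ) : ℝ := A * vw / (A * vw + vv)

lemma minError_nonneg {vx vv vw p : ℝ} (hvx : 0 ≤ vx) (hvv : 0 ≤ vv) (hvw : 0 ≤ vw) (hp : 0 ≤ p) :
    0 ≤ minError vx vv vw p := by
  unfold minError
  positivity

lemma minError_sq_mul_eq_div {vx vv vw A : ℝ} (hvx : 0 < vx) (hvv : 0 < vv) (hvw : 0 < vw) :
    minError vx vv vw (A ^ 2 * vx) = vx * vw * vv / ((A ^ 2 * vw + vv) * vx + vw * vv) := by
  unfold minError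
  field_simp
  ring

section Combining

variable {Ω : Type*} [MeasurableSpace Ω] {P : Measure Ω} {X V W : Ω → ℝ} {vx vv vw : ℝ≥0}
  {γ : Encoder}

-- The defect in the Cauchy-Schwarz inequality, given by Lagrange's identity.
lemma combinedSignal_sq_add (hvv : 0 < vv) (hvw : 0 < vw) (γ : Encoder) (α x : ℝ) :
    combinedSignal γ α x ^ 2 +
        (α * vv * x - (1 - α) * vw * γ.message x) ^ 2 / (vv * vw : ℝ) =
      noiseVar vv vw α * (x ^ 2 / vw + γ.message x ^ 2 / vv) := by
  have hvv' : (vv : ℝ) ≠ 0 := NNReal.coe_ne_zero.2 hvv.ne'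
  have hvw' : (vw : ℝ) ≠ 0 := NNReal.coe_ne_zero.2 hvw.ne'
  rw [coe_noiseVar, combinedSignal]
  field_simp
  ring

lemma memLp_combinedSignal (hγ : MemLp γ.message 2 (gaussianReal 0 vx)) (α : ℝ) :
    MemLp (combinedSignal γ α) 2 (gaussianReal 0 vx) :=
  (hγ.const_mul α).add ((memLp_id_gaussianReal 2).const_mul (1 - α))

lemma memLp_mismatch (hγ : MemLp γ.message 2 (gaussianReal 0 vx)) (α : ℝ) :
    MemLp (fun x => α * vv * x - (1 - α) * vw * γ.message x) 2 (gaussianReal 0 vx) :=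
  ((memLp_id_gaussianReal 2).const_mul (α * vv)).sub (hγ.const_mul ((1 - α) * vw))

lemma integral_combinedSignal_sq_add (hvv : 0 < vv) (hvw : 0 < vw)
    (hγ : MemLp γ.message 2 (gaussianReal 0 vx)) (α : ℝ) :
    ∫ x, combinedSignal γ α x ^ 2 ∂gaussianReal 0 vx +
        (∫ x, (α * vv * x - (1 - α) * vw * γ.message x) ^ 2 ∂gaussianReal 0 vx) / (vv * vw : ℝ) =
      noiseVar vv vw α * (vx / vw + γ.power (gaussianReal 0 vx) / vv) := by
  have hsource : Integrable (fun x : ℝ => x ^ 2) (gaussianReal 0 vx) :=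
    (memLp_id_gaussianReal 2).integrable_sq
  rw [← integral_div, ← integral_add (memLp_combinedSignal hγ α).integrable_sq
    ((memLp_mismatch hγ α).integrable_sq.div_const _)]
  simp only [combinedSignal_sq_add hvv hvw]
  rw [integral_const_mul, integral_add (hsource.div_const _) (hγ.integrable_sq.div_const _),
    integral_div, integral_div, integral_sq_gaussianReal, Encoder.power]

lemma IsGaussianModel.le_decoderCost (h : IsGaussianModel P X V W vx vv vw) (hvx : 0 < vx)
    (hvv : 0 < vv) (hvw : 0 < vw) (hγ : MemLp γ.message 2 (gaussianReal 0 vx)) (d : Decoder) :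
    ENNReal.ofReal (vx * noiseVar vv vw d.ratio /
        (∫ x, combinedSignal γ d.ratio x ^ 2 ∂gaussianReal 0 vx + noiseVar vv vw d.ratio)) ≤
      decoderCost P X V W γ d := by
  rw [h.decoderCost_eq_channelError]
  exact le_channelError hvx.ne' (noiseVar_ne_zero hvv hvw _) (measurable_combinedSignal γ _)
    (memLp_combinedSignal hγ _) d.measurable_estimate

lemma IsGaussianModel.minError_le_decoderCost (h : IsGaussianModel P X V W vx vv vw)
    (hvx : 0 < vx) (hvv : 0 < vv) (hvw : 0 < vw) (hγ : MemLp γ.message 2 (gaussianReal 0 vx))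
    (d : Decoder) :
    ENNReal.ofReal (minError vx vv vw (γ.power (gaussianReal 0 vx))) ≤
      decoderCost P X V W γ d := by
  refine (ENNReal.ofReal_le_ofReal ?_).trans (h.le_decoderCost hvx hvv hvw hγ d)
  have hcombine := integral_combinedSignal_sq_add hvv hvw hγ d.ratio
  have hmismatch : 0 ≤ (∫ x, (d.ratio * vv * x - (1 - d.ratio) * vw * γ.message x) ^ 2
      ∂gaussianReal 0 vx) / (vv * vw : ℝ) :=
    div_nonneg (integral_nonneg fun x => sq_nonneg _) (by positivity)
  have hp := γ.power_nonneg (gaussianReal 0 vx)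
  have hN : (0 : ℝ) < noiseVar vv vw d.ratio :=
    NNReal.coe_pos.2 (pos_of_ne_zero (noiseVar_ne_zero hvv hvw _))
  rw [minError, div_le_div_iff₀ (by positivity) (by positivity), mul_assoc]
  refine mul_le_mul_of_nonneg_left ?_ vx.coe_nonneg
  linarith

lemma IsGaussianModel.mismatch_ae_eq_zero (h : IsGaussianModel P X V W vx vv vw)
    (hvx : 0 < vx) (hvv : 0 < vv) (hvw : 0 < vw) (hγ : MemLp γ.message 2 (gaussianReal 0 vx))
    {d : Decoder} (hd : decoderCost P X V W γ d ≤
      ENNReal.ofReal (minError vx vv vw (γ.power (gaussianReal 0 vx)))) :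
    ∀ᵐ x ∂gaussianReal 0 vx, d.ratio * vv * x = (1 - d.ratio) * vw * γ.message x := by
  have hp := γ.power_nonneg (gaussianReal 0 vx)
  have hcombine := integral_combinedSignal_sq_add hvv hvw hγ d.ratio
  have hN : (0 : ℝ) < noiseVar vv vw d.ratio :=
    NNReal.coe_pos.2 (pos_of_ne_zero (noiseVar_ne_zero hvv hvw _))
  have hvx' : (0 : ℝ) < vx := hvx
  have hvv' : (0 : ℝ) < vv := hvv
  have hvw' : (0 : ℝ) < vw := hvw
  have hle := (h.le_decoderCost hvx hvv hvw hγ d).trans hd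
  rw [ENNReal.ofReal_le_ofReal_iff (minError_nonneg hvx'.le hvv'.le hvw'.le hp), minError,
    div_le_div_iff₀ (by positivity) (by positivity), mul_assoc, mul_le_mul_iff_right₀ hvx'] at hle
  set G := ∫ x, (d.ratio * vv * x - (1 - d.ratio) * vw * γ.message x) ^ 2 ∂gaussianReal 0 vx
    with hG
  have hG₀ : G / (vv * vw : ℝ) ≤ 0 := by linarith
  have hG₁ : G = 0 := le_antisymm (by simpa using (div_le_iff₀ (by positivity)).1 hG₀)
    (integral_nonneg fun x => sq_nonneg _)
  rw [hG, integral_eq_zero_iff_of_nonneg (fun x => sq_nonneg _)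
    (memLp_mismatch hγ _).integrable_sq] at hG₁
  filter_upwards [hG₁] with x hx
  exact sub_eq_zero.1 (pow_eq_zero_iff two_ne_zero |>.1 hx)

lemma exists_linear_of_mismatch_ae_eq_zero (hvx : 0 < vx) (hvv : 0 < vv) (hvw : 0 < vw)
    {d : Decoder} (hd : ∀ᵐ x ∂gaussianReal 0 vx,
      d.ratio * vv * x = (1 - d.ratio) * vw * γ.message x) :
    ∃ a : ℝ, 0 ≤ a ∧ γ.message =ᵐ[gaussianReal 0 vx] (Encoder.linear a).message ∧
      d.ratio = matchedRatio vv vw a := by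
  obtain ⟨hα₀, hα₁⟩ := d.ratio_mem
  have hα : d.ratio ≠ 1 := by
    intro hα
    have := nullSingletonClass_gaussianReal (μ := 0) hvx.ne'
    obtain ⟨x, hx, hx₀⟩ := (hd.and (Measure.ae_ne (gaussianReal 0 vx) 0)).exists
    simp [hα, hvv.ne', hx₀] at hx
  refine ⟨d.ratio * vv / ((1 - d.ratio) * vw), by positivity, ?_, ?_⟩
  · filter_upwards [hd] with x hx
    simp only [Encoder.linear]
    rw [div_mul_eq_mul_div, eq_div_iff (by positivity), hx, mul_comm]
  · rw [matchedRatio, eq_div_iff (by positivity)]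
    field_simp
    ring

end Combining

/-! ### The trade-off between power and accuracy -/

section Tradeoff

-- The two sides differ by `(t - t₀) * (w * t₀ ^ 2 - u) / t₀ ^ 2`.
lemma add_sq_div_le_div_add_mul {u w t t₀ : ℝ} (ht : 0 < t) (ht₀ : 0 < t₀)
    (hstat : 0 ≤ (t - t₀) * (w * t₀ ^ 2 - u)) :
    u / t₀ + w * t₀ + u * (t - t₀) ^ 2 / (t * t₀ ^ 2) ≤ u / t + w * t := by
  have hdiff : u / t + w * t - (u / t₀ + w * t₀ + u * (t - t₀) ^ 2 / (t * t₀ ^ 2)) =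
      (t - t₀) * (w * t₀ ^ 2 - u) / t₀ ^ 2 := by
    field_simp
    ring
  have := div_nonneg hstat (sq_nonneg t₀)
  linarith

/-- The gain of the encoder that is optimal for the unit price `θ` of transmit power. -/
def optimalGain (vx vv vw θ : ℝ) : ℝ :=
  √(max 0 (√(vv / (θ * vx)) - vv / vx * (vx / vw + 1)))

lemma optimalGain_nonneg (vx vv vw θ : ℝ) : 0 ≤ optimalGain vx vv vw θ := Real.sqrt_nonneg _

variable {vx vv vw θ : ℝ} (hvx : 0 < vx) (hvv : 0 < vv) (hvw : 0 < vw) (hθ : 0 < θ)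

include hvx hvv hvw hθ

lemma mul_div_add_one_lt_sqrt_iff :
    vv / vx * (vx / vw + 1) < √(vv / (θ * vx)) ↔ θ < vx / (vv * (vx / vw + 1) ^ 2) := by
  rw [Real.lt_sqrt (by positivity), lt_div_iff₀ (by positivity), lt_div_iff₀ (by positivity)]
  have hscale : (vv / vx * (vx / vw + 1)) ^ 2 * (θ * vx) =
      vv / vx * (θ * (vv * (vx / vw + 1) ^ 2)) := by
    field_simp
  rw [hscale, div_mul_eq_mul_div, div_lt_iff₀ hvx, mul_lt_mul_iff_right₀ hvv]

lemma optimalGain_pos_iff :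
    0 < optimalGain vx vv vw θ ↔ θ < vx / (vv * (vx / vw + 1) ^ 2) := by
  rw [← mul_div_add_one_lt_sqrt_iff hvx hvv hvw hθ, optimalGain, Real.sqrt_pos, lt_max_iff,
    sub_pos, or_iff_right (lt_irrefl _)]

lemma optimalGain_sq :
    optimalGain vx vv vw θ ^ 2 = if θ < vx / (vv * (vx / vw + 1) ^ 2) then
      √(vv / (θ * vx)) - vv / vx * (vx / vw + 1) else 0 := by
  rw [optimalGain, Real.sq_sqrt (le_max_left _ _)]
  split_ifs with hcase <;> rw [← mul_div_add_one_lt_sqrt_iff hvx hvv hvw hθ] at hcase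
  · exact max_eq_right (sub_nonneg.2 hcase.le)
  · exact max_eq_left (sub_nonpos.2 (not_lt.1 hcase))

lemma optimalGain_stationary {p : ℝ} (hp : 0 ≤ p) :
    0 ≤ (p - optimalGain vx vv vw θ ^ 2 * vx) *
      (θ * vv * (1 + vx / vw + optimalGain vx vv vw θ ^ 2 * vx / vv) ^ 2 - vx) := by
  rw [optimalGain_sq hvx hvv hvw hθ]
  split_ifs with hcase
  · have hlevel : 1 + vx / vw + (√(vv / (θ * vx)) - vv / vx * (vx / vw + 1)) * vx / vv =
        √(vv / (θ * vx)) * (vx / vv) := by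
      field_simp
      ring
    rw [hlevel, mul_pow, Real.sq_sqrt (by positivity)]
    apply le_of_eq
    field_simp
    ring
  · rw [not_lt, div_le_iff₀ (by positivity)] at hcase
    have hlevel : 1 + vx / vw + 0 * vx / vv = vx / vw + 1 := by ring
    rw [hlevel, zero_mul, sub_zero]
    exact mul_nonneg hp (by linarith)

lemma minError_optimalGain_add_lt {p : ℝ} (hp : 0 ≤ p) (hne : p ≠ optimalGain vx vv vw θ ^ 2 * vx) :
    minError vx vv vw (optimalGain vx vv vw θ ^ 2 * vx) + θ * (optimalGain vx vv vw θ ^ 2 * vx) <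
      minError vx vv vw p + θ * p := by
  have hstat := optimalGain_stationary hvx hvv hvw hθ hp
  have hp₀ : 0 ≤ optimalGain vx vv vw θ ^ 2 * vx := by positivity
  generalize optimalGain vx vv vw θ ^ 2 * vx = p₀ at *
  set m := 1 + vx / vw with hm
  have hdiff : m + p / vv - (m + p₀ / vv) = (p - p₀) / vv := by ring
  have hle := add_sq_div_le_div_add_mul (u := vx) (w := θ * vv) (t := m + p / vv)
    (t₀ := m + p₀ / vv) (by positivity) (by positivity) (by
      rw [hdiff, div_mul_eq_mul_div]
      exact div_nonneg hstat hvv.le)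
  have hgap : 0 < vx * (m + p / vv - (m + p₀ / vv)) ^ 2 / ((m + p / vv) * (m + p₀ / vv) ^ 2) := by
    have hpow := pow_pos (abs_pos.2 (sub_ne_zero.2 hne)) 2
    rw [sq_abs] at hpow
    rw [hdiff]
    positivity
  have hcost (q : ℝ) : θ * vv * (m + q / vv) = θ * vv * m + θ * q := by field_simp
  rw [hcost, hcost] at hle
  unfold minError
  rw [← hm]
  linarith

lemma minError_optimalGain_add_le {p : ℝ} (hp : 0 ≤ p) :
    minError vx vv vw (optimalGain vx vv vw θ ^ 2 * vx) + θ * (optimalGain vx vv vw θ ^ 2 * vx) ≤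
      minError vx vv vw p + θ * p := by
  rcases eq_or_ne p (optimalGain vx vv vw θ ^ 2 * vx) with rfl | hne
  · rfl
  · exact (minError_optimalGain_add_lt hvx hvv hvw hθ hp hne).le

end Tradeoff

/-! ### Linear strategies -/

lemma channelError_const_mul (vx vn : ℝ≥0) (c k : ℝ) :
    channelError (gaussianReal 0 vx) vn (fun x => c * x) (fun r => k * r) =
      ENNReal.ofReal ((1 - k * c) ^ 2 * vx + k ^ 2 * vn) := by
  have hsource : MemLp (fun x => (1 - k * c) * x) 2 (gaussianReal 0 vx) :=
    (memLp_id_gaussianReal 2).const_mul _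
  have hnoise : MemLp (fun n => -k * n) 2 (gaussianReal 0 vn) :=
    (memLp_id_gaussianReal 2).const_mul _
  have herror (z : ℝ × ℝ) :
      z.1 - k * (c * z.1 + z.2) = (1 - k * c) * z.1 + -k * z.2 := by ring
  have hint : Integrable (fun z : ℝ × ℝ => ((1 - k * c) * z.1 + -k * z.2) ^ 2)
      ((gaussianReal 0 vx).prod (gaussianReal 0 vn)) :=
    ((hsource.comp_fst _).add (hnoise.comp_snd _)).integrable_sq
  simp only [channelError, herror]
  rw [← ofReal_integral_eq_lintegral_ofReal hint (ae_of_all _ fun z => sq_nonneg _),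
    integral_sq_fst_add_snd hsource hnoise (by rw [integral_const_mul]; simp)]
  simp only [mul_pow, neg_sq]
  rw [integral_const_mul, integral_const_mul, integral_sq_gaussianReal, integral_sq_gaussianReal]

/-- The gain of the estimator that is optimal for a linear encoder of gain `A` whose message is
combined with the ratio `matchedRatio vv vw A`. -/
def estimatorGain (vx vv vw A : ℝ) : ℝ :=
  (A * vx * vw + vx * vv) / (A ^ 2 * vx * vw + vx * vv + vw * vv)

/-- The linear response of the decoder to a linear encoder of gain `A`. -/
def linearDecoder (vx vv vw : ℝ≥0) {A : ℝ} (hA : 0 ≤ A) : Decoder where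
  ratio := matchedRatio vv vw A
  ratio_mem := ⟨by unfold matchedRatio; positivity,
    div_le_one_of_le₀ (le_add_of_nonneg_right vv.coe_nonneg) (by positivity)⟩
  estimate := fun r => estimatorGain vx vv vw A * r
  measurable_estimate := measurable_const_mul _

lemma estimatorGain_error_eq_minError {vx vv vw A : ℝ} (hvx : 0 < vx) (hvv : 0 < vv)
    (hvw : 0 < vw) (hA : 0 ≤ A) :
    (1 - estimatorGain vx vv vw A *
        (matchedRatio vv vw A * A + (1 - matchedRatio vv vw A))) ^ 2 * vx +
      estimatorGain vx vv vw A ^ 2 *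
        (matchedRatio vv vw A ^ 2 * vv + (1 - matchedRatio vv vw A) ^ 2 * vw) =
    minError vx vv vw (A ^ 2 * vx) := by
  have hratio : 1 - matchedRatio vv vw A = vv / (A * vw + vv) := by
    unfold matchedRatio
    field_simp
    ring
  have herror : 1 - estimatorGain vx vv vw A * (matchedRatio vv vw A * A + vv / (A * vw + vv)) =
      vw * vv / (A ^ 2 * vx * vw + vx * vv + vw * vv) := by
    unfold matchedRatio estimatorGain
    field_simp
    ring
  rw [hratio, herror, minError, matchedRatio, estimatorGain]
  field_simp
  ring

lemma power_of_ae_eq_linear {γ : Encoder} {A : ℝ} {vx : ℝ≥0}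
    (hγ : γ.message =ᵐ[gaussianReal 0 vx] (Encoder.linear A).message) :
    γ.power (gaussianReal 0 vx) = A ^ 2 * vx := by
  rw [← integral_sq_gaussianReal, ← integral_const_mul]
  refine integral_congr_ae ?_
  filter_upwards [hγ] with x hx
  rw [hx, ← mul_pow]
  rfl

lemma memLp_of_ae_eq_linear {γ : Encoder} {A : ℝ} {vx : ℝ≥0}
    (hγ : γ.message =ᵐ[gaussianReal 0 vx] (Encoder.linear A).message) :
    MemLp γ.message 2 (gaussianReal 0 vx) :=
  (memLp_congr_ae hγ).2 ((memLp_id_gaussianReal 2).const_mul A)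

section Linear

variable {Ω : Type*} [MeasurableSpace Ω] {P : Measure Ω} {X V W : Ω → ℝ} {vx vv vw : ℝ≥0}
  {γ : Encoder} {d : Decoder} {A b θ : ℝ}

section Model

variable (h : IsGaussianModel P X V W vx vv vw) (hvx : 0 < vx) (hvv : 0 < vv) (hvw : 0 < vw)

include h hvx hvv hvw

lemma IsGaussianModel.decoderCost_linearDecoder (hA : 0 ≤ A)
    (hγ : γ.message =ᵐ[gaussianReal 0 vx] (Encoder.linear A).message) :
    decoderCost P X V W γ (linearDecoder vx vv vw hA) =
      ENNReal.ofReal (minError vx vv vw (A ^ 2 * vx)) := by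
  have hsignal : combinedSignal γ (matchedRatio vv vw A) =ᵐ[gaussianReal 0 vx]
      fun x => (matchedRatio vv vw A * A + (1 - matchedRatio vv vw A)) * x := by
    filter_upwards [hγ] with x hx
    rw [combinedSignal, hx]
    simp only [Encoder.linear]
    ring
  rw [h.decoderCost_eq_channelError, ← estimatorGain_error_eq_minError (NNReal.coe_pos.2 hvx)
      (NNReal.coe_pos.2 hvv) (NNReal.coe_pos.2 hvw) hA,
    ← coe_noiseVar, ← channelError_const_mul]
  exact channelError_congr _ hsignal _

lemma IsGaussianModel.isBestResponse_linearDecoder (hA : 0 ≤ A)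
    (hγ : γ.message =ᵐ[gaussianReal 0 vx] (Encoder.linear A).message) :
    IsBestResponse P X V W γ (linearDecoder vx vv vw hA) := fun d' => by
  rw [h.decoderCost_linearDecoder hvx hvv hvw hA hγ, ← power_of_ae_eq_linear hγ]
  exact h.minError_le_decoderCost hvx hvv hvw (memLp_of_ae_eq_linear hγ) d'

lemma IsBestResponse.decoderCost_of_ae_eq_linear (hd : IsBestResponse P X V W γ d) (hA : 0 ≤ A)
    (hγ : γ.message =ᵐ[gaussianReal 0 vx] (Encoder.linear A).message) :
    decoderCost P X V W γ d = ENNReal.ofReal (minError vx vv vw (A ^ 2 * vx)) := by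
  rw [← h.decoderCost_linearDecoder hvx hvv hvw hA hγ]
  exact le_antisymm (hd _) (h.isBestResponse_linearDecoder hvx hvv hvw hA hγ d)

lemma IsBestResponse.estimate_ae_eq_mul (hd : IsBestResponse P X V W γ d) (hA : 0 ≤ A)
    (hγ : γ.message =ᵐ[gaussianReal 0 vx] (Encoder.linear A).message)
    (hratio : d.ratio = matchedRatio vv vw A) :
    ∀ᵐ r, d.estimate r = estimatorGain vx vv vw A * r := by
  have hd' := h.isBestResponse_linearDecoder hvx hvv hvw hA hγ
  have hpost := hd.estimate_ae_eq_posteriorMean h hvv hvw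
  rw [hratio] at hpost
  exact hpost.trans (hd'.estimate_ae_eq_posteriorMean h hvv hvw).symm

lemma IsBestResponse.encoderCost_of_ae_eq_linear (hd : IsBestResponse P X V W γ d) (hA : 0 ≤ A)
    (hγ : γ.message =ᵐ[gaussianReal 0 vx] (Encoder.linear A).message) (hθ : 0 ≤ θ) (b : ℝ) :
    encoderCost P X V W b θ γ d =
      ENNReal.ofReal (minError vx vv vw (A ^ 2 * vx) + θ * (A ^ 2 * vx) + b ^ 2) := by
  have := h.isProbabilityMeasure
  rw [hd.encoderCost_eq_ofReal h.hasLaw_source (memLp_id_gaussianReal 2)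
      h.hasLaw_encoderNoise.aemeasurable h.hasLaw_sideNoise.aemeasurable hθ b
      (memLp_of_ae_eq_linear hγ),
    hd.decoderCost_of_ae_eq_linear h hvx hvv hvw hA hγ, power_of_ae_eq_linear hγ,
    ENNReal.toReal_ofReal
      (minError_nonneg vx.coe_nonneg vv.coe_nonneg vw.coe_nonneg (by positivity))]

/-! ### Equilibria -/

lemma IsBestResponse.minError_add_le_encoderCost (hd : IsBestResponse P X V W γ d) (hθ : 0 < θ)
    (b : ℝ) :
    ENNReal.ofReal (minError vx vv vw (γ.power (gaussianReal 0 vx)) +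
      θ * γ.power (gaussianReal 0 vx) + b ^ 2) ≤ encoderCost P X V W b θ γ d := by
  by_cases hfin : encoderCost P X V W b θ γ d = ∞
  · simp [hfin]
  have := h.isProbabilityMeasure
  have hX₂ : MemLp id 2 (gaussianReal 0 vx) := memLp_id_gaussianReal 2
  have hV := h.hasLaw_encoderNoise.aemeasurable
  have hW := h.hasLaw_sideNoise.aemeasurable
  have hγ := hd.memLp_message h.hasLaw_source hX₂ hV hW hθ hfin
  have hdecoder := ENNReal.ofReal_le_iff_le_toReal
    (hd.decoderCost_ne_top (memLp_two_of_hasLaw h.hasLaw_source hX₂)) |>.1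
    (h.minError_le_decoderCost hvx hvv hvw hγ d)
  rw [hd.encoderCost_eq_ofReal h.hasLaw_source hX₂ hV hW hθ.le b hγ]
  gcongr

lemma IsBestResponse.exists_linear_of_encoderCost_le (hd : IsBestResponse P X V W γ d)
    (hθ : 0 < θ) (hle : encoderCost P X V W b θ γ d ≤
      ENNReal.ofReal (minError vx vv vw (γ.power (gaussianReal 0 vx)) +
        θ * γ.power (gaussianReal 0 vx) + b ^ 2)) :
    ∃ a : ℝ, 0 ≤ a ∧ γ.message =ᵐ[gaussianReal 0 vx] (Encoder.linear a).message ∧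
      d.ratio = matchedRatio vv vw a := by
  have := h.isProbabilityMeasure
  have hX₂ : MemLp id 2 (gaussianReal 0 vx) := memLp_id_gaussianReal 2
  have hV := h.hasLaw_encoderNoise.aemeasurable
  have hW := h.hasLaw_sideNoise.aemeasurable
  have hγ := hd.memLp_message h.hasLaw_source hX₂ hV hW hθ
    (ne_top_of_le_ne_top ENNReal.ofReal_ne_top hle)
  have hp := γ.power_nonneg (gaussianReal 0 vx)
  have hmin : 0 ≤ minError vx vv vw (γ.power (gaussianReal 0 vx)) :=
    minError_nonneg vx.coe_nonneg vv.coe_nonneg vw.coe_nonneg hp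
  rw [hd.encoderCost_eq_ofReal h.hasLaw_source hX₂ hV hW hθ.le b hγ,
    ENNReal.ofReal_le_ofReal_iff (by positivity)] at hle
  refine exists_linear_of_mismatch_ae_eq_zero hvx hvv hvw
    (h.mismatch_ae_eq_zero hvx hvv hvw hγ ?_)
  rw [ENNReal.le_ofReal_iff_toReal_le
    (hd.decoderCost_ne_top (memLp_two_of_hasLaw h.hasLaw_source hX₂)) hmin]
  linarith

lemma exists_isStackelbergEquilibrium (hθ : 0 < θ) (b : ℝ) :
    ∃ δ : Encoder → Decoder,
      IsStackelbergEquilibrium P X V W b θ (Encoder.linear (optimalGain vx vv vw θ)) δ ∧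
      δ (Encoder.linear (optimalGain vx vv vw θ)) =
        linearDecoder vx vv vw (optimalGain_nonneg vx vv vw θ) := by
  classical
  set A := optimalGain vx vv vw θ
  have hA : 0 ≤ A := optimalGain_nonneg vx vv vw θ
  choose δ₀ hδ₀ using h.exists_isBestResponse hvv hvw
  set δ := Function.update δ₀ (Encoder.linear A) (linearDecoder vx vv vw hA)
  have hlinear : δ (Encoder.linear A) = linearDecoder vx vv vw hA := Function.update_self ..
  have hδ (γ : Encoder) : IsBestResponse P X V W γ (δ γ) := by
    rcases eq_or_ne γ (Encoder.linear A) with rfl | hγ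
    · rw [hlinear]
      exact h.isBestResponse_linearDecoder hvx hvv hvw hA .rfl
    · simpa only [δ, Function.update_of_ne hγ] using hδ₀ γ
  refine ⟨δ, ⟨hδ, fun γ => ?_⟩, hlinear⟩
  rw [(hδ _).encoderCost_of_ae_eq_linear h hvx hvv hvw hA .rfl hθ.le]
  refine le_trans (ENNReal.ofReal_le_ofReal ?_)
    ((hδ γ).minError_add_le_encoderCost h hvx hvv hvw hθ b)
  exact add_le_add_left (minError_optimalGain_add_le (NNReal.coe_pos.2 hvx) (NNReal.coe_pos.2 hvv)
    (NNReal.coe_pos.2 hvw) hθ (γ.power_nonneg _)) _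

lemma IsStackelbergEquilibrium.encoderCost_le {δ : Encoder → Decoder}
    (heq : IsStackelbergEquilibrium P X V W b θ γ δ) (hθ : 0 ≤ θ) {A : ℝ} (hA : 0 ≤ A) :
    encoderCost P X V W b θ γ (δ γ) ≤
      ENNReal.ofReal (minError vx vv vw (A ^ 2 * vx) + θ * (A ^ 2 * vx) + b ^ 2) := by
  rw [← (heq.follower (Encoder.linear A)).encoderCost_of_ae_eq_linear h hvx hvv hvw hA .rfl hθ]
  exact heq.leader _

lemma IsStackelbergEquilibrium.power_eq {δ : Encoder → Decoder}
    (heq : IsStackelbergEquilibrium P X V W b θ γ δ) (hθ : 0 < θ) :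
    γ.power (gaussianReal 0 vx) = optimalGain vx vv vw θ ^ 2 * vx := by
  by_contra hne
  have hlt := minError_optimalGain_add_lt (NNReal.coe_pos.2 hvx) (NNReal.coe_pos.2 hvv)
    (NNReal.coe_pos.2 hvw) hθ (γ.power_nonneg (gaussianReal 0 vx)) hne
  have hmin : 0 ≤ minError vx vv vw (optimalGain vx vv vw θ ^ 2 * vx) :=
    minError_nonneg vx.coe_nonneg vv.coe_nonneg vw.coe_nonneg (by positivity)
  have hle := ((heq.follower γ).minError_add_le_encoderCost h hvx hvv hvw hθ b).trans
    (heq.encoderCost_le h hvx hvv hvw hθ.le (optimalGain_nonneg vx vv vw θ))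
  rw [ENNReal.ofReal_le_ofReal_iff (by positivity)] at hle
  linarith

lemma IsStackelbergEquilibrium.ae_eq_linear {δ : Encoder → Decoder}
    (heq : IsStackelbergEquilibrium P X V W b θ γ δ) (hθ : 0 < θ) :
    γ.message =ᵐ[gaussianReal 0 vx] (Encoder.linear (optimalGain vx vv vw θ)).message ∧
      (δ γ).ratio = matchedRatio vv vw (optimalGain vx vv vw θ) := by
  have hp := heq.power_eq h hvx hvv hvw hθ
  have hle := heq.encoderCost_le h hvx hvv hvw hθ.le (optimalGain_nonneg vx vv vw θ)
  rw [← hp] at hle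
  obtain ⟨a, ha, hmessage, hratio⟩ :=
    (heq.follower γ).exists_linear_of_encoderCost_le h hvx hvv hvw hθ hle
  rw [power_of_ae_eq_linear hmessage, mul_left_inj' (NNReal.coe_ne_zero.2 hvx.ne'),
    sq_eq_sq₀ ha (optimalGain_nonneg ..)] at hp
  exact hp ▸ ⟨hmessage, hratio⟩

end Model
end Linear

end SignalingGame

end

theorem mainTheorem1 {Ω : Type*} [MeasurableSpace Ω] (P : Measure Ω) [IsProbabilityMeasure P]
    (X V W : Ω → ℝ) (σx σv σw b θ : ℝ)
    (hσx : 0 < σx) (hσv : 0 < σv) (hσw : 0 < σw) (hθ : 0 < θ)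
    (hX : HasLaw X (gaussianReal 0 (Real.toNNReal (σx ^ 2))) P)
    (hV : HasLaw V (gaussianReal 0 (Real.toNNReal (σv ^ 2))) P)
    (hW : HasLaw W (gaussianReal 0 (Real.toNNReal (σw ^ 2))) P)
    (hindep : iIndepFun ![X, V, W] P) :
    ∃ A α K Jd : ℝ,
      0 ≤ A ∧ 0 ≤ K ∧
      A ^ 2 = (if θ < σx ^ 2 / (σv ^ 2 * (σx ^ 2 / σw ^ 2 + 1) ^ 2) then
          √(σv ^ 2 / (θ * σx ^ 2)) - σv ^ 2 / σx ^ 2 * (σx ^ 2 / σw ^ 2 + 1)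
        else 0) ∧
      (0 < A ↔ θ < σx ^ 2 / (σv ^ 2 * (σx ^ 2 / σw ^ 2 + 1) ^ 2)) ∧
      α = A * σw ^ 2 / (A * σw ^ 2 + σv ^ 2) ∧
      K = (A * σx ^ 2 * σw ^ 2 + σx ^ 2 * σv ^ 2) /
        (A ^ 2 * σx ^ 2 * σw ^ 2 + σx ^ 2 * σv ^ 2 + σw ^ 2 * σv ^ 2) ∧
      Jd = σx ^ 2 * σw ^ 2 * σv ^ 2 /
        ((A ^ 2 * σw ^ 2 + σv ^ 2) * σx ^ 2 + σw ^ 2 * σv ^ 2) ∧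
      (∃ δ : SignalingGame.Encoder → SignalingGame.Decoder,
        SignalingGame.IsStackelbergEquilibrium P X V W b θ (SignalingGame.Encoder.linear A) δ ∧
        (δ (SignalingGame.Encoder.linear A)).ratio = α ∧
        (δ (SignalingGame.Encoder.linear A)).estimate = fun r => K * r) ∧
      (∀ (γ : SignalingGame.Encoder) (δ : SignalingGame.Encoder → SignalingGame.Decoder),
        SignalingGame.IsStackelbergEquilibrium P X V W b θ γ δ →
          (∀ᵐ x, γ.message x = A * x) ∧
          (δ γ).ratio = α ∧
          (∀ᵐ r, (δ γ).estimate r = K * r) ∧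
          SignalingGame.decoderCost P X V W γ (δ γ) = ENNReal.ofReal Jd ∧
          SignalingGame.encoderCost P X V W b θ γ (δ γ) =
            ENNReal.ofReal (Jd + θ * A ^ 2 * σx ^ 2 + b ^ 2)) := by
  have hvx : 0 < σx ^ 2 := by positivity
  have hvv : 0 < σv ^ 2 := by positivity
  have hvw : 0 < σw ^ 2 := by positivity
  generalize σx ^ 2 = vx at *
  generalize σv ^ 2 = vv at *
  generalize σw ^ 2 = vw at *
  lift vx to NNReal using hvx.le
  lift vv to NNReal using hvv.le
  lift vw to NNReal using hvw.le
  rw [Real.toNNReal_coe] at hX hV hW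
  have hmodel : SignalingGame.IsGaussianModel P X V W vx vv vw := ⟨hX, hV, hW, hindep⟩
  have hA := SignalingGame.optimalGain_nonneg vx vv vw θ
  refine ⟨SignalingGame.optimalGain vx vv vw θ, _, _, _, hA, by positivity,
    SignalingGame.optimalGain_sq hvx hvv hvw hθ, SignalingGame.optimalGain_pos_iff hvx hvv hvw hθ,
    rfl, rfl, rfl, ?_, fun γ δ hδ => ?_⟩
  · obtain ⟨δ, hδ, hlinear⟩ :=
      SignalingGame.exists_isStackelbergEquilibrium hmodel hvx hvv hvw hθ b
    exact ⟨δ, hδ, by rw [hlinear]; rfl, by rw [hlinear]; rfl⟩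
  · obtain ⟨hmessage, hratio⟩ := hδ.ae_eq_linear hmodel hvx hvv hvw hθ
    have hbest := hδ.follower γ
    rw [← SignalingGame.minError_sq_mul_eq_div hvx hvv hvw, mul_assoc θ]
    exact ⟨(gaussianReal_absolutelyContinuous' 0 (ne_of_gt hvx)).ae_le hmessage, hratio,
      hbest.estimate_ae_eq_mul hmodel hvx hvv hvw hA hmessage hratio,
      hbest.decoderCost_of_ae_eq_linear hmodel hvx hvv hvw hA hmessage,
      hbest.encoderCost_of_ae_eq_linear hmodel hvx hvv hvw hA hmessage hθ.le b⟩
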